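/- Let $m_1,m_2,m_3,m_4>0$ and let $q_1,q_2,q_3,q_4\in\mathbb R^2$ be distinct points with distances $r_{ij}=\|q_i-q_j\|$ forming a central configuration: for some real $\ell$, \[ \ell\, m_i\,(q_i-q_{CM})=\sum_{j\ne i}\frac{m_im_j(q_j-q_i)}{r_{ij}^3}\quad(1\le i\le 4),\qquad q_{CM}=\frac{\sum_i m_iq_i}{\sum_i m_i}. \] Suppose the configuration is standard convex: no three of the points are collinear, no point lies in the convex hull of the other three, and the points are numbered consecutively along the boundary of the convex quadrilateral they determine, so that the segments $q_1q_3$ and $q_2q_4$ are its diagonals. Let $\theta_{ijk}\in(0,\pi)$ be the angle at $q_j$ of the triangle $q_iq_jq_k$ and $\theta\in(0,\pi)$ the angle between the diagonal vectors $q_3-q_1$ and $q_4-q_2$. Consider the central configuration equations in terms of angles, with Lagrange multipliers $\lambda,\eta_1\in\mathbb R$: \begin{align*} r_{12}^{-3}&=\lambda+\tfrac{\eta_1}{m_1m_2}\left[\cot\theta-\cot\theta_{142}\right],\\ r_{13}^{-3}&=\lambda+\tfrac{\eta_1}{m_1m_3}\left[\tfrac{r_{24}}{r_{13}}\csc\theta\right],\\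 r_{14}^{-3}&=\lambda+\tfrac{\eta_1}{m_1m_4}\left[-\cot\theta-\cot\theta_{124}\right],\\ r_{23}^{-3}&=\lambda+\tfrac{\eta_1}{m_2m_3}\left[-\cot\theta-\cot\theta_{243}\right],\\ r_{24}^{-3}&=\lambda+\tfrac{\eta_1}{m_2m_4}\left[\tfrac{r_{13}}{r_{24}}\csc\theta-\cot\theta_{234}-\cot\theta_{214}\right],\\ r_{34}^{-3}&=\lambda+\tfrac{\eta_1}{m_3m_4}\left[\cot\theta-\cot\theta_{324}\right], \end{align*} together with $\Delta=A_1+A_3$, where $\Delta=\frac12\|(q_3-q_1)\times(q_4-q_2)\|$ and $A_1$, $A_3$ are the areas of the triangles $q_2q_3q_4$ and $q_1q_2q_4$. Then there are $\lambda,\eta_1\in\mathbb R$ satisfying these equations, and every such $\eta_1$ is negative: $\eta_1<0$. -/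

import Mathlib

noncomputable section

namespace FourBody

/-- The Euclidean plane. -/
abbrev Plane : Type := EuclideanSpace ℝ (Fin 2)

/-- The scalar cross product of two plane vectors; its absolute value is the length of the usual
cross product. -/
def cross (u v : Plane) : ℝ := u 0 * v 1 - u 1 * v 0

/-- Planar central configurations of four bodies with masses `m` and (distinct) positions `q`:
`l mᵢ (qᵢ - q_CM) = ∑_{j ≠ i} mᵢ mⱼ (qⱼ - qᵢ) / rᵢⱼ³` for some real `l` and all `i`. -/
def IsCentralConfiguration (m : Fin 4 → ℝ) (q : Fin 4 → Plane) : Prop :=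
  Function.Injective q ∧
    ∃ l : ℝ, ∀ i : Fin 4,
      (l * m i) • (q i - Finset.univ.centerMass m q) =
        ∑ j ∈ Finset.univ.erase i, (m i * m j / dist (q i) (q j) ^ 3) • (q j - q i)

/-- Standard planar convex configurations. The bodies `1, 2, 3, 4` have indices `0, 1, 2, 3`. -/
structure IsStandardConvex (q : Fin 4 → Plane) : Prop where
  /-- No two points coincide and no three points lie on a line. -/
  nondegenerate : ∀ i j k : Fin 4, i ≠ j → i ≠ k → j ≠ k → ¬ Collinear ℝ {q i, q j, q k}
  /-- No point lies in the convex hull of the others. -/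
  convex : ConvexIndependent ℝ q
  /-- The points are numbered consecutively along the boundary of the convex quadrilateral, so
  that `12, 23, 34, 14` are its sides and `13, 24` its diagonals: among the three ways to pair the
  vertices, the diagonals are the pair of segments that cross. -/
  ordered : (segment ℝ (q 0) (q 2) ∩ segment ℝ (q 1) (q 3)).Nonempty

/-- The angle between the diagonal vectors `q₃ - q₁` and `q₄ - q₂`. -/
def diagonalAngle (q : Fin 4 → Plane) : ℝ :=
  InnerProductGeometry.angle (q 2 - q 0) (q 3 - q 1)

/-- `θᵢⱼₖ`, the angle at the vertex `j` of the triangle `i j k`. -/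
def vertexAngle (q : Fin 4 → Plane) (i j k : Fin 4) : ℝ :=
  EuclideanGeometry.angle (q i) (q j) (q k)

/-- The planarity constraint function `F₁ = Δ - A₁ - A₃`: half the length of the cross product of
the diagonals, minus the areas of the triangles `2 3 4` and `1 2 4`. -/
def planarityConstraint (q : Fin 4 → Plane) : ℝ :=
  |cross (q 2 - q 0) (q 3 - q 1)| / 2
    - |cross (q 2 - q 1) (q 3 - q 2)| / 2
    - |cross (q 0 - q 3) (q 1 - q 0)| / 2

/-- The equations in terms of angles for four-body central configurations, with Lagrange
multipliers `l` (for the moment of inertia) and `η₁` (for the constraint `F₁ = 0`). -/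
structure AngleEquations (m : Fin 4 → ℝ) (q : Fin 4 → Plane) (l η₁ : ℝ) : Prop where
  eq12 : (dist (q 0) (q 1) ^ 3)⁻¹ = l + η₁ / (m 0 * m 1) *
    (Real.cot (diagonalAngle q) - Real.cot (vertexAngle q 0 3 1))
  eq13 : (dist (q 0) (q 2) ^ 3)⁻¹ = l + η₁ / (m 0 * m 2) *
    (dist (q 1) (q 3) / dist (q 0) (q 2) * (Real.sin (diagonalAngle q))⁻¹)
  eq14 : (dist (q 0) (q 3) ^ 3)⁻¹ = l + η₁ / (m 0 * m 3) *
    (-Real.cot (diagonalAngle q) - Real.cot (vertexAngle q 0 1 3))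
  eq23 : (dist (q 1) (q 2) ^ 3)⁻¹ = l + η₁ / (m 1 * m 2) *
    (-Real.cot (diagonalAngle q) - Real.cot (vertexAngle q 1 3 2))
  eq24 : (dist (q 1) (q 3) ^ 3)⁻¹ = l + η₁ / (m 1 * m 3) *
    (dist (q 0) (q 2) / dist (q 1) (q 3) * (Real.sin (diagonalAngle q))⁻¹
      - Real.cot (vertexAngle q 1 2 3) - Real.cot (vertexAngle q 1 0 3))
  eq34 : (dist (q 2) (q 3) ^ 3)⁻¹ = l + η₁ / (m 2 * m 3) *
    (Real.cot (diagonalAngle q) - Real.cot (vertexAngle q 2 1 3))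
  planar : planarityConstraint q = 0

end FourBody

end

namespace FourBody

/-! Let the diagonals `e`, `f` meet at fractions `s`, `t` of their lengths. Every bracket in the
angle equations is then a rational function of `s`, `t` times the positive number `‖f‖ ^ 2 / |cross
e f|`, negative on the four sides and positive on the two diagonals.

Existence: resolved along `e` and `f`, the central configuration equations are linear in the six
numbers `rᵢⱼ⁻³ - l`. They fix them up to one common factor, and the brackets divided by mass
products solve the same system; the factor is `η₁`.

Sign: if `η₁ ≥ 0`, then `rᵢⱼ⁻³` is at most `l` on sides and at least `l` on diagonals, so no side is
shorter than a diagonal. `exists_side_lt_diagonal` excludes this. -/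

theorem inner_eq (x y : Plane) : inner ℝ x y = x 0 * y 0 + x 1 * y 1 := by
  simp [PiLp.inner_apply, Fin.sum_univ_two, mul_comm]

theorem norm_sq_eq (x : Plane) : ‖x‖ ^ 2 = x 0 ^ 2 + x 1 ^ 2 := by
  simp [EuclideanSpace.norm_sq_eq, Fin.sum_univ_two]

theorem sin_angle_mul (x y : Plane) :
    Real.sin (InnerProductGeometry.angle x y) * (‖x‖ * ‖y‖) = |cross x y| := by
  rw [InnerProductGeometry.sin_angle_mul_norm_mul_norm, ← Real.sqrt_sq_eq_abs]
  congr 1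
  simp only [inner_eq, cross]
  ring

theorem cot_angle (x y : Plane) :
    Real.cot (InnerProductGeometry.angle x y) = (x 0 * y 0 + x 1 * y 1) / |cross x y| := by
  rw [Real.cot_eq_cos_div_sin, ← inner_eq, ← sin_angle_mul,
    ← InnerProductGeometry.cos_angle_mul_norm_mul_norm]
  by_cases hx : x = 0
  · simp [hx]
  by_cases hy : y = 0
  · simp [hy]
  have h : ‖x‖ * ‖y‖ ≠ 0 := mul_ne_zero (norm_ne_zero_iff.2 hx) (norm_ne_zero_iff.2 hy)
  rw [mul_div_mul_right _ _ h]

theorem collinear_of_cross_eq_zero {a b c : Plane} (h : cross (b - a) (c - a) = 0) :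
    Collinear ℝ {a, b, c} := by
  rw [collinear_iff_of_mem (p₀ := a) (by simp)]
  by_cases hb : b = a
  · refine ⟨c - a, fun p hp => ?_⟩
    rcases hp with rfl | rfl | rfl
    · exact ⟨0, by simp⟩
    · exact ⟨0, by simp [hb]⟩
    · exact ⟨1, by simp⟩
  have hn : (b - a) 0 ^ 2 + (b - a) 1 ^ 2 ≠ 0 := by
    rw [← norm_sq_eq]
    exact pow_ne_zero 2 (norm_ne_zero_iff.2 (sub_ne_zero.2 hb))
  refine ⟨b - a, fun p hp => ?_⟩
  rcases hp with rfl | rfl | rfl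
  · exact ⟨0, by simp⟩
  · exact ⟨1, by simp⟩
  -- The coefficient of the orthogonal projection of `p - a` onto `b - a`.
  · refine ⟨((b - a) 0 * (p - a) 0 + (b - a) 1 * (p - a) 1) /
      ((b - a) 0 ^ 2 + (b - a) 1 ^ 2), ?_⟩
    simp only [cross] at h
    rw [vadd_eq_add, ← sub_eq_iff_eq_add]
    ext i
    rw [PiLp.smul_apply, smul_eq_mul, div_mul_eq_mul_div, eq_div_iff hn]
    fin_cases i
    · change (p - a) 0 * _ = _ * (b - a) 0
      linear_combination (-(b - a) 1) * h
    · change (p - a) 1 * _ = _ * (b - a) 1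
      linear_combination (b - a) 0 * h

/-- The cotangent of a vertex angle whose triangle has `r` times the area spanned by `e` and `f`. -/
theorem cot_vertexAngle {q : Fin 4 → Plane} {e f : Plane} {i j k : Fin 4} {r A : ℝ}
    (hr : 0 < r)
    (hc : |cross (q i - q j) (q k - q j)| = r * |cross e f|)
    (hA : (q i - q j) 0 * (q k - q j) 0 + (q i - q j) 1 * (q k - q j) 1 = r * A) :
    Real.cot (vertexAngle q i j k) = A / |cross e f| := by
  rw [vertexAngle, EuclideanGeometry.angle, vsub_eq_sub, vsub_eq_sub, cot_angle, hc, hA,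
    mul_div_mul_left _ _ hr.ne']

theorem abs_eq_mul {x r c : ℝ} (hr : 0 < r) (hx : x = r * c ∨ x = -(r * c)) :
    |x| = r * |c| := by
  rcases hx with rfl | rfl
  · rw [abs_mul, abs_of_pos hr]
  · rw [abs_neg, abs_mul, abs_of_pos hr]

/-! ### Coordinates from the crossing point of the diagonals -/

/-- The diagonals `e` and `f` of the quadrilateral `q` meet at `q 0 + s • e = q 1 + t • f`,
in the interior of both. -/
structure CrossingDiagonals (q : Fin 4 → Plane) (e f : Plane) (s t : ℝ) : Prop where
  s_pos : 0 < s
  s_lt : s < 1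
  t_pos : 0 < t
  t_lt : t < 1
  cross_ne : cross e f ≠ 0
  q1 : q 1 = q 0 + s • e - t • f
  q2 : q 2 = q 0 + e
  q3 : q 3 = q 0 + s • e + (1 - t) • f

theorem IsStandardConvex.exists_crossingDiagonals {q : Fin 4 → Plane}
    (h : IsStandardConvex q) : ∃ e f s t, CrossingDiagonals q e f s t := by
  obtain ⟨p, h02, h13⟩ := h.ordered
  rw [segment_eq_image'] at h02 h13
  obtain ⟨s, ⟨hs0, hs1⟩, hs⟩ := h02
  obtain ⟨t, ⟨ht0, ht1⟩, ht⟩ := h13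
  simp only at hs ht
  obtain ⟨e, he⟩ : ∃ e, e = q 2 - q 0 := ⟨_, rfl⟩
  obtain ⟨f, hf⟩ : ∃ f, f = q 3 - q 1 := ⟨_, rfl⟩
  rw [← he] at hs
  rw [← hf] at ht
  have h1 : q 1 = q 0 + s • e - t • f := by rw [hs, ← ht]; abel
  have h2 : q 2 = q 0 + e := by rw [he]; abel
  have h3 : q 3 = q 0 + s • e + (1 - t) • f := by
    rw [sub_smul, one_smul, hs, ← ht, hf]; abel
  -- The four triangles have areas proportional to `t`, `s`, `1 - t`, `1 - s`; nondegeneracy makes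
  -- the crossing point interior to both diagonals.
  have n : ∀ i j k : Fin 4, i ≠ j → i ≠ k → j ≠ k → cross (q j - q i) (q k - q i) ≠ 0 :=
    fun i j k hij hik hjk h0 => h.nondegenerate i j k hij hik hjk (collinear_of_cross_eq_zero h0)
  have n1 : cross e f ≠ 0 ∧ t ≠ 0 := by
    have := n 0 2 1 (by decide) (by decide) (by decide)
    rw [show cross (q 2 - q 0) (q 1 - q 0) = -(cross e f * t) by
      simp [h1, h2, cross]; ring] at this
    simpa using this
  have n2 : s ≠ 0 := by
    have := n 0 1 3 (by decide) (by decide) (by decide)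
    rw [show cross (q 1 - q 0) (q 3 - q 0) = cross e f * s by
      simp [h1, h3, cross]; ring] at this
    exact right_ne_zero_of_mul this
  have n3 : 1 - t ≠ 0 := by
    have := n 0 2 3 (by decide) (by decide) (by decide)
    rw [show cross (q 2 - q 0) (q 3 - q 0) = cross e f * (1 - t) by
      simp [h2, h3, cross]; ring] at this
    exact right_ne_zero_of_mul this
  have n4 : 1 - s ≠ 0 := by
    have := n 1 2 3 (by decide) (by decide) (by decide)
    rw [show cross (q 2 - q 1) (q 3 - q 1) = cross e f * (1 - s) by
      simp [h1, h2, h3, cross]; ring] at this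
    exact right_ne_zero_of_mul this
  exact ⟨e, f, s, t, hs0.lt_of_ne' n2, hs1.lt_of_ne (fun h => n4 (by simp [h])),
    ht0.lt_of_ne' n1.2, ht1.lt_of_ne (fun h => n3 (by simp [h])), n1.1, h1, h2, h3⟩

namespace CrossingDiagonals

variable {q : Fin 4 → Plane} {e f : Plane} {s t : ℝ}

theorem sub_eq (h : CrossingDiagonals q e f s t) : q 2 - q 0 = e ∧ q 3 - q 1 = f := by
  constructor
  · rw [h.q2]; abel
  · rw [h.q1, h.q3, sub_smul, one_smul]; abel

theorem abs_cross_pos (h : CrossingDiagonals q e f s t) : 0 < |cross e f| :=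
  abs_pos.2 h.cross_ne

theorem cot_diagonalAngle (h : CrossingDiagonals q e f s t) :
    Real.cot (diagonalAngle q) = (e 0 * f 0 + e 1 * f 1) / |cross e f| := by
  rw [diagonalAngle, h.sub_eq.1, h.sub_eq.2, cot_angle]

theorem norm_pos (h : CrossingDiagonals q e f s t) : 0 < ‖e‖ ∧ 0 < ‖f‖ := by
  constructor <;> refine norm_pos_iff.2 fun h0 => h.cross_ne ?_ <;> simp [h0, cross]

theorem inv_sin_diagonalAngle (h : CrossingDiagonals q e f s t) :
    (Real.sin (diagonalAngle q))⁻¹ = ‖e‖ * ‖f‖ / |cross e f| := by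
  have := h.norm_pos
  rw [diagonalAngle, h.sub_eq.1, h.sub_eq.2, ← sin_angle_mul, mul_comm (Real.sin _),
    ← div_div, div_self (mul_pos this.1 this.2).ne', one_div]

/-! ### The six brackets and the planarity constraint -/

theorem bracket12 (h : CrossingDiagonals q e f s t) :
    Real.cot (diagonalAngle q) - Real.cot (vertexAngle q 0 3 1) =
      -((1 - t) / s * (‖f‖ ^ 2 / |cross e f|)) := by
  have hs := h.s_pos
  rw [h.cot_diagonalAngle, cot_vertexAngle (e := e) (f := f)
    (A := e 0 * f 0 + e 1 * f 1 + (1 - t) / s * (f 0 ^ 2 + f 1 ^ 2)) hs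
    (abs_eq_mul hs (.inl (by simp [h.q1, h.q3, cross]; ring)))
    (by simp [h.q1, h.q3]; field_simp; ring), norm_sq_eq]
  ring

theorem bracket13 (h : CrossingDiagonals q e f s t) :
    dist (q 1) (q 3) / dist (q 0) (q 2) * (Real.sin (diagonalAngle q))⁻¹ =
      ‖f‖ ^ 2 / |cross e f| := by
  have := h.norm_pos.1
  rw [h.inv_sin_diagonalAngle, dist_comm, dist_comm (q 0), dist_eq_norm, dist_eq_norm,
    h.sub_eq.1, h.sub_eq.2]
  field_simp

theorem bracket14 (h : CrossingDiagonals q e f s t) :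
    -Real.cot (diagonalAngle q) - Real.cot (vertexAngle q 0 1 3) =
      -(t / s * (‖f‖ ^ 2 / |cross e f|)) := by
  have hs := h.s_pos
  rw [h.cot_diagonalAngle, cot_vertexAngle (e := e) (f := f)
    (A := -(e 0 * f 0 + e 1 * f 1) + t / s * (f 0 ^ 2 + f 1 ^ 2)) hs
    (abs_eq_mul hs (.inr (by simp [h.q1, h.q3, cross]; ring)))
    (by simp [h.q1, h.q3]; field_simp; ring), norm_sq_eq]
  ring

theorem bracket23 (h : CrossingDiagonals q e f s t) :
    -Real.cot (diagonalAngle q) - Real.cot (vertexAngle q 1 3 2) =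
      -((1 - t) / (1 - s) * (‖f‖ ^ 2 / |cross e f|)) := by
  have hs := sub_pos.2 h.s_lt
  rw [h.cot_diagonalAngle, cot_vertexAngle (e := e) (f := f)
    (A := -(e 0 * f 0 + e 1 * f 1) + (1 - t) / (1 - s) * (f 0 ^ 2 + f 1 ^ 2)) hs
    (abs_eq_mul hs (.inl (by simp [h.q1, h.q2, h.q3, cross]; ring)))
    (by simp [h.q1, h.q2, h.q3]; field_simp; ring), norm_sq_eq]
  ring

theorem bracket34 (h : CrossingDiagonals q e f s t) :
    Real.cot (diagonalAngle q) - Real.cot (vertexAngle q 2 1 3) =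
      -(t / (1 - s) * (‖f‖ ^ 2 / |cross e f|)) := by
  have hs := sub_pos.2 h.s_lt
  rw [h.cot_diagonalAngle, cot_vertexAngle (e := e) (f := f)
    (A := (e 0 * f 0 + e 1 * f 1) + t / (1 - s) * (f 0 ^ 2 + f 1 ^ 2)) hs
    (abs_eq_mul hs (.inl (by simp [h.q1, h.q2, h.q3, cross]; ring)))
    (by simp [h.q1, h.q2, h.q3]; field_simp; ring), norm_sq_eq]
  ring

/-- The two triangles on the diagonal `f` take fractions `s` and `1 - s` of the total area. In the
sum of their cotangents the `e · f` terms cancel, and the `‖e‖ ^ 2` terms cancel against the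
cosecant term. -/
theorem bracket24 (h : CrossingDiagonals q e f s t) :
    dist (q 0) (q 2) / dist (q 1) (q 3) * (Real.sin (diagonalAngle q))⁻¹
      - Real.cot (vertexAngle q 1 2 3) - Real.cot (vertexAngle q 1 0 3) =
      t * (1 - t) / (s * (1 - s)) * (‖f‖ ^ 2 / |cross e f|) := by
  have hs := h.s_pos
  have hs' := sub_pos.2 h.s_lt
  have hK := h.abs_cross_pos
  have hd : dist (q 0) (q 2) / dist (q 1) (q 3) * (Real.sin (diagonalAngle q))⁻¹ =
      ‖e‖ ^ 2 / |cross e f| := by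
    have := h.norm_pos.2
    rw [h.inv_sin_diagonalAngle, dist_comm, dist_comm (q 1), dist_eq_norm, dist_eq_norm,
      h.sub_eq.1, h.sub_eq.2]
    field_simp
  rw [hd, cot_vertexAngle (e := e) (f := f) (i := 1) (j := 2)
    (A := (1 - s) * (e 0 ^ 2 + e 1 ^ 2) - t * (1 - t) / (1 - s) * (f 0 ^ 2 + f 1 ^ 2)
      + (2 * t - 1) * (e 0 * f 0 + e 1 * f 1)) hs'
    (abs_eq_mul hs' (.inr (by simp [h.q1, h.q2, h.q3, cross]; ring)))
    (by simp [h.q1, h.q2, h.q3]; field_simp; ring),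
    cot_vertexAngle (e := e) (f := f) (i := 1) (j := 0)
    (A := s * (e 0 ^ 2 + e 1 ^ 2) - t * (1 - t) / s * (f 0 ^ 2 + f 1 ^ 2)
      - (2 * t - 1) * (e 0 * f 0 + e 1 * f 1)) hs
    (abs_eq_mul hs (.inl (by simp [h.q1, h.q3, cross]; ring)))
    (by simp [h.q1, h.q3]; field_simp; ring), norm_sq_eq, norm_sq_eq]
  field_simp
  ring

theorem planarityConstraint_eq_zero (h : CrossingDiagonals q e f s t) :
    planarityConstraint q = 0 := by
  have hs := h.s_pos
  have hs' := sub_pos.2 h.s_lt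
  rw [planarityConstraint, h.sub_eq.1, h.sub_eq.2,
    abs_eq_mul (x := cross (q 2 - q 1) (q 3 - q 2)) (c := cross e f) hs'
      (.inl (by simp [h.q1, h.q2, h.q3, cross]; ring)),
    abs_eq_mul (x := cross (q 0 - q 3) (q 1 - q 0)) (c := cross e f) hs
      (.inl (by simp [h.q1, h.q3, cross]; ring))]
  ring

/-- A planar vector is determined by its components along the two diagonals. -/
theorem smul_add_smul_eq_zero (h : CrossingDiagonals q e f s t) {x y : ℝ}
    (hxy : x • e + y • f = 0) : x = 0 ∧ y = 0 := by
  have h0 : x * e 0 + y * f 0 = 0 := by simpa using congrArg (fun v : Plane => v 0) hxy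
  have h1 : x * e 1 + y * f 1 = 0 := by simpa using congrArg (fun v : Plane => v 1) hxy
  constructor
  · refine (mul_eq_zero.1 (?_ : x * cross e f = 0)).resolve_right h.cross_ne
    simp only [cross]; linear_combination f 1 * h0 - f 0 * h1
  · refine (mul_eq_zero.1 (?_ : y * cross e f = 0)).resolve_right h.cross_ne
    simp only [cross]; linear_combination e 0 * h1 - e 1 * h0

/-- In a convex quadrilateral the diagonals are not both at most as long as every side. -/
theorem exists_side_lt_diagonal (h : CrossingDiagonals q e f s t)
    (h01 : ‖e‖ ≤ dist (q 0) (q 1) ∧ ‖f‖ ≤ dist (q 0) (q 1))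
    (h12 : ‖e‖ ≤ dist (q 1) (q 2) ∧ ‖f‖ ≤ dist (q 1) (q 2))
    (h23 : ‖e‖ ≤ dist (q 2) (q 3) ∧ ‖f‖ ≤ dist (q 2) (q 3))
    (h03 : ‖e‖ ≤ dist (q 0) (q 3) ∧ ‖f‖ ≤ dist (q 0) (q 3)) : False := by
  have hs := h.s_pos
  have hs' := sub_pos.2 h.s_lt
  have ht := h.t_pos
  have ht' := sub_pos.2 h.t_lt
  have hE := pow_pos h.norm_pos.1 2
  have hF := pow_pos h.norm_pos.2 2
  have key : ∀ {x : Plane} {i j : Fin 4}, ‖x‖ ≤ dist (q i) (q j) →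
      ‖x‖ ^ 2 ≤ (q i - q j) 0 ^ 2 + (q i - q j) 1 ^ 2 := fun {x i j} hx => by
    rw [← norm_sq_eq, ← dist_eq_norm]
    exact pow_le_pow_left₀ (norm_nonneg _) hx 2
  have a1 := key h01.1
  have a2 := key h23.2
  have b1 := key h03.1
  have b2 := key h12.2
  simp [h.q1, h.q2, h.q3] at a1 a2 b1 b2
  have c1 := norm_sq_eq e
  have c2 := norm_sq_eq f
  have p1 := mul_pos (mul_pos hs hs') hE
  have p2 := mul_pos (mul_pos ht ht') hF
  -- The sign of `e · f` selects a pair of opposite sides whose squares sum to less than `‖e‖ ^ 2 +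
  -- ‖f‖ ^ 2`; comparing one with `e` and the other with `f` is contradictory.
  rcases le_total 0 (e 0 * f 0 + e 1 * f 1) with hD | hD
  · have := mul_nonneg (add_pos (mul_pos hs ht) (mul_pos hs' ht')).le hD
    rw [c1] at a1 p1
    rw [c2] at a2 p2
    linarith
  · have := mul_nonneg (add_pos (mul_pos hs ht') (mul_pos hs' ht)).le (neg_nonneg.2 hD)
    rw [c1] at b1 p1
    rw [c2] at b2 p2
    linarith

end CrossingDiagonals

/-! ### Existence of the multipliers -/

/-- The equations of central configurations with the center of mass eliminated. -/
theorem IsCentralConfiguration.exists_multiplier {m : Fin 4 → ℝ} (hm : ∀ i, 0 < m i)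
    {q : Fin 4 → Plane} (h : IsCentralConfiguration m q) :
    ∃ l : ℝ, ∀ i, ∑ j, (m j * ((dist (q i) (q j) ^ 3)⁻¹ - l)) • (q j - q i) = 0 := by
  obtain ⟨-, l, hl⟩ := h
  have hM : 0 < ∑ i, m i := Finset.sum_pos (fun i _ => hm i) Finset.univ_nonempty
  refine ⟨-(l / ∑ i, m i), fun i => ?_⟩
  have hc : (∑ k, m k)⁻¹ • ∑ j, m j • (q j - q i) = Finset.univ.centerMass m q - q i := by
    simp only [smul_sub, Finset.sum_sub_distrib, ← Finset.sum_smul]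
    rw [smul_smul, inv_mul_cancel₀ hM.ne', one_smul, Finset.centerMass]
  have hi := hl i
  -- The term `j = i` can be restored because `q i - q i = 0`.
  rw [Finset.sum_erase Finset.univ (by simp)] at hi
  have hm' := (hm i).ne'
  have hi' : l • (q i - Finset.univ.centerMass m q) =
      ∑ j, (m j / dist (q i) (q j) ^ 3) • (q j - q i) := by
    apply smul_right_injective Plane hm'
    simp only [Finset.smul_sum, smul_smul]
    rw [mul_comm, hi]
    exact Finset.sum_congr rfl fun j _ => by rw [mul_div_assoc]
  rw [← neg_sub, ← hc] at hi'
  have e1 : ∑ j, (m j * ((dist (q i) (q j) ^ 3)⁻¹ - -(l / ∑ k, m k))) • (q j - q i) =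
      ∑ j, (m j / dist (q i) (q j) ^ 3) • (q j - q i) +
        l • ((∑ k, m k)⁻¹ • ∑ j, m j • (q j - q i)) := by
    rw [Finset.smul_sum, Finset.smul_sum, ← Finset.sum_add_distrib]
    refine Finset.sum_congr rfl fun j _ => ?_
    rw [smul_smul, smul_smul, ← add_smul]
    congr 1
    ring
  rw [e1, ← hi']
  simp

theorem CrossingDiagonals.exists_angleEquations {m : Fin 4 → ℝ} (hm : ∀ i, 0 < m i)
    {q : Fin 4 → Plane} {e f : Plane} {s t : ℝ} (h : CrossingDiagonals q e f s t)
    (hcc : IsCentralConfiguration m q) : ∃ l η₁ : ℝ, AngleEquations m q l η₁ := by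
  obtain ⟨l, hl⟩ := hcc.exists_multiplier hm
  obtain ⟨S, hS⟩ : ∃ S : Fin 4 → Fin 4 → ℝ, ∀ i j, S i j = (dist (q i) (q j) ^ 3)⁻¹ - l :=
    ⟨_, fun _ _ => rfl⟩
  have hsymm : ∀ i j, S i j = S j i := fun i j => by rw [hS, hS, dist_comm]
  simp only [← hS, Fin.sum_univ_four] at hl
  have hs := h.s_pos
  have hs' := sub_pos.2 h.s_lt
  have ht := h.t_pos
  have ht' := sub_pos.2 h.t_lt
  have m0 := hm 0
  have m1 := hm 1
  have m2 := hm 2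
  have m3 := hm 3
  -- Components along `e` and `f` of the equations for three of the bodies; these already determine
  -- every `S i j` from `S 0 1`.
  have i0 : s * (m 1 * S 0 1) + m 2 * S 0 2 + s * (m 3 * S 0 3) = 0 ∧
      -t * (m 1 * S 0 1) + (1 - t) * (m 3 * S 0 3) = 0 := by
    apply h.smul_add_smul_eq_zero
    rw [← hl 0, h.q1, h.q2, h.q3]
    module
  have i1 : -s * (m 0 * S 0 1) + (1 - s) * (m 2 * S 1 2) = 0 ∧
      t * (m 0 * S 0 1) + t * (m 2 * S 1 2) + m 3 * S 1 3 = 0 := by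
    apply h.smul_add_smul_eq_zero
    rw [← hl 1, hsymm 1 0, h.q1, h.q2, h.q3]
    module
  have i2 : m 0 * S 0 2 + (1 - s) * (m 1 * S 1 2) + (1 - s) * (m 3 * S 2 3) = 0 ∧
      t * (m 1 * S 1 2) - (1 - t) * (m 3 * S 2 3) = 0 := by
    apply h.smul_add_smul_eq_zero
    rw [← neg_eq_zero, ← hl 2, hsymm 2 0, hsymm 2 1, h.q1, h.q2, h.q3]
    module
  obtain ⟨G, hG⟩ : ∃ G, G = ‖f‖ ^ 2 / |cross e f| := ⟨_, rfl⟩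
  have hG0 : 0 < G := hG ▸ div_pos (pow_pos h.norm_pos.2 2) h.abs_cross_pos
  -- `η` is chosen so that the equation for the side `q 0`, `q 1` holds.
  obtain ⟨η, hη⟩ : ∃ η, m 0 * m 1 * s * S 0 1 = -(η * ((1 - t) * G)) :=
    ⟨-(m 0 * m 1 * s * S 0 1) / ((1 - t) * G), by field_simp⟩
  have r01 : S 0 1 = -(η * ((1 - t) * G)) / (m 0 * m 1 * s) := by
    rw [eq_div_iff (by positivity)]; linear_combination hη
  have r03 : S 0 3 = -(η * (t * G)) / (m 0 * m 3 * s) := by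
    have : S 0 3 = t * (m 1 * S 0 1) / ((1 - t) * m 3) := by
      rw [eq_div_iff (by positivity)]; linear_combination i0.2
    rw [this, r01]; field_simp
  have r12 : S 1 2 = -(η * ((1 - t) * G)) / (m 1 * m 2 * (1 - s)) := by
    have : S 1 2 = s * (m 0 * S 0 1) / ((1 - s) * m 2) := by
      rw [eq_div_iff (by positivity)]; linear_combination i1.1
    rw [this, r01]; field_simp
  have r23 : S 2 3 = -(η * (t * G)) / (m 2 * m 3 * (1 - s)) := by
    have : S 2 3 = t * (m 1 * S 1 2) / ((1 - t) * m 3) := by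
      rw [eq_div_iff (by positivity)]; linear_combination -i2.2
    rw [this, r12]; field_simp
  have r02 : S 0 2 = η * G / (m 0 * m 2) := by
    have : S 0 2 = -(s * (m 1 * S 0 1 + m 3 * S 0 3)) / m 2 := by
      rw [eq_div_iff (by positivity)]; linear_combination i0.1
    rw [this, r01, r03]; field_simp; ring
  have r13 : S 1 3 = η * (t * (1 - t) * G) / (m 1 * m 3 * (s * (1 - s))) := by
    have : S 1 3 = -(t * (m 0 * S 0 1 + m 2 * S 1 2)) / m 3 := by
      rw [eq_div_iff (by positivity)]; linear_combination i1.2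
    rw [this, r01, r12]; field_simp; ring
  refine ⟨l, η, ?_, ?_, ?_, ?_, ?_, ?_, h.planarityConstraint_eq_zero⟩
  · rw [h.bracket12, ← hG, ← sub_eq_iff_eq_add', ← hS, r01]; field_simp
  · rw [h.bracket13, ← hG, ← sub_eq_iff_eq_add', ← hS, r02]; field_simp
  · rw [h.bracket14, ← hG, ← sub_eq_iff_eq_add', ← hS, r03]; field_simp
  · rw [h.bracket23, ← hG, ← sub_eq_iff_eq_add', ← hS, r12]; field_simp
  · rw [h.bracket24, ← hG, ← sub_eq_iff_eq_add', ← hS, r13]; field_simp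
  · rw [h.bracket34, ← hG, ← sub_eq_iff_eq_add', ← hS, r23]; field_simp

/-! ### Sign of the multiplier -/

theorem CrossingDiagonals.multiplier_neg {m : Fin 4 → ℝ} (hm : ∀ i, 0 < m i)
    {q : Fin 4 → Plane} {e f : Plane} {s t : ℝ} (h : CrossingDiagonals q e f s t)
    (hq : Function.Injective q) {l η₁ : ℝ} (ha : AngleEquations m q l η₁) : η₁ < 0 := by
  by_contra! hη
  have hs := h.s_pos
  have hs' := sub_pos.2 h.s_lt
  have ht := h.t_pos
  have ht' := sub_pos.2 h.t_lt
  have m0 := hm 0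
  have m1 := hm 1
  have m2 := hm 2
  have m3 := hm 3
  have hG0 : 0 < ‖f‖ ^ 2 / |cross e f| := div_pos (pow_pos h.norm_pos.2 2) h.abs_cross_pos
  -- A side has a bracket of the form `-c`, so its inverse cube is at most `l`, hence at most that
  -- of any length `d` with `l ≤ (d ^ 3)⁻¹`.
  have side : ∀ {i j : Fin 4} {b c : ℝ}, (dist (q i) (q j) ^ 3)⁻¹ = l + b * -c →
      i ≠ j → 0 ≤ b → 0 ≤ c → ∀ {d : ℝ}, 0 < d → l ≤ (d ^ 3)⁻¹ → d ≤ dist (q i) (q j) := by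
    intro i j b c hd hij hb hc d hd0 hld
    have hpos : 0 < dist (q i) (q j) := dist_pos.2 (hq.ne hij)
    have hle : (dist (q i) (q j) ^ 3)⁻¹ ≤ (d ^ 3)⁻¹ := by
      linarith [mul_nonneg hb hc]
    rw [inv_le_inv₀ (by positivity) (by positivity)] at hle
    exact le_of_pow_le_pow_left₀ three_ne_zero hpos.le hle
  have he : l ≤ (‖e‖ ^ 3)⁻¹ := by
    have := ha.eq13
    rw [h.bracket13, dist_comm, dist_eq_norm, h.sub_eq.1] at this
    rw [this]
    exact le_add_of_nonneg_right (by positivity)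
  have hf : l ≤ (‖f‖ ^ 3)⁻¹ := by
    have := ha.eq24
    rw [h.bracket24, dist_comm, dist_eq_norm, h.sub_eq.2] at this
    rw [this]
    exact le_add_of_nonneg_right (by positivity)
  have e01 := @side _ _ _ _ (h.bracket12 ▸ ha.eq12) (by decide) (by positivity) (by positivity)
  have e03 := @side _ _ _ _ (h.bracket14 ▸ ha.eq14) (by decide) (by positivity) (by positivity)
  have e12 := @side _ _ _ _ (h.bracket23 ▸ ha.eq23) (by decide) (by positivity) (by positivity)
  have e23 := @side _ _ _ _ (h.bracket34 ▸ ha.eq34) (by decide) (by positivity) (by positivity)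
  have n1 := h.norm_pos.1
  have n2 := h.norm_pos.2
  exact h.exists_side_lt_diagonal ⟨e01 n1 he, e01 n2 hf⟩ ⟨e12 n1 he, e12 n2 hf⟩
    ⟨e23 n1 he, e23 n2 hf⟩ ⟨e03 n1 he, e03 n2 hf⟩

end FourBody

theorem mainTheorem9 (m : Fin 4 → ℝ) (hm : ∀ i, 0 < m i)
    (q : Fin 4 → FourBody.Plane)
    (hcc : FourBody.IsCentralConfiguration m q)
    (hstd : FourBody.IsStandardConvex q) :
    (∃ l η₁ : ℝ, FourBody.AngleEquations m q l η₁) ∧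
      ∀ l η₁ : ℝ, FourBody.AngleEquations m q l η₁ → η₁ < 0 := by
  obtain ⟨e, f, s, t, h⟩ := hstd.exists_crossingDiagonals
  exact ⟨h.exists_angleEquations hm hcc, fun l η₁ ha => h.multiplier_neg hm hcc.1 ha⟩
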